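/- Let $1<\theta<\infty$ and $r>0$ be real, let $(X,\mu)$ be a standard Borel space with a non-zero $\sigma$-finite measure without atoms, and let $\mathbb K\in\{\mathbb R,\mathbb C\}$. For $f,g\colon X\to\mathbb K$ write $\langle f,g\rangle_\mu=\int_X f\bar g\,d\mu$ and let $\mathbf N_\theta(e)(x)=|e(x)|^{\theta-2}e(x)$ if $e(x)\neq 0$, $\mathbf N_\theta(e)(x)=0$ if $e(x)=0$. Consider, for a real constant $c$, the inequality $$\bigg|\bigg\langle f,\frac{\mathbf N_\theta(e)}{\|e\|_{L^\theta(\mu)}^{\theta-1}}\bigg\rangle_\mu\bigg|^{r}+c\,\inf_{\alpha\in\mathbb K}\|f-\alpha e\|_{L^\theta(\mu)}^{r}\le\|f\|_{L^\theta(\mu)}^{r}\qquad\text{for all } \mathbb K\text{-valued } e,f\in L^\theta(X,\mu),\ e\neq 0. \tag{$*$}$$ There is a largest $c$ for which $(*)$ holds; denote it by $c^{\star}_{\theta,r}$ if $\mathbb K=\mathbb C$ and by $c^{\star,\mathbb R}_{\theta,r}$ if $\mathbb K=\mathbb R$. Neither constant depends on the choice of $(X,\mu)$, and $$c^{\star,\mathbb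 R}_{\theta,r}=c^{\star}_{\theta,r}.$$ Explicitly: if $(X,\mu)$ and $(Y,\nu)$ are any two measure spaces as above, the largest constant for real-valued functions on $(X,\mu)$ equals the largest constant for complex-valued functions on $(Y,\nu)$. -/

import Mathlib

open MeasureTheory

noncomputable section

namespace SharpHolder

/-- The form `⟨f, g⟩_μ = ∫ f ḡ dμ`, for real- or complex-valued functions. -/
def pairing {𝕜 : Type*} [RCLike 𝕜] {X : Type*} [MeasurableSpace X] (μ : Measure X)
    (f g : X → 𝕜) : 𝕜 :=
  ∫ x, f x * (starRingEnd 𝕜) (g x) ∂μ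

open Classical in
/-- The nonlinear operator `N_s`: `N_s(h)(x) = |h(x)|^(s-2) h(x)` where `h(x) ≠ 0`,
and `0` where `h(x) = 0`. -/
def nonlinearN {𝕜 : Type*} [RCLike 𝕜] {X : Type*} (s : ℝ) (h : X → 𝕜) (x : X) : 𝕜 :=
  if h x = 0 then 0 else ((‖h x‖ ^ (s - 2) : ℝ) : 𝕜) * h x

/-- The constant `c` is admissible for the exponents `θ, r` and the scalar field `𝕜` on `(X, μ)`:
for all `e, f ∈ L^θ(X, μ; 𝕜)` with `e ≠ 0`,
`|⟨f, N_θ(e) / ‖e‖^(θ-1)⟩|^r + c * inf_α ‖f - α e‖^r ≤ ‖f‖^r`,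
where all norms are `L^θ`-norms and `α` ranges over the scalars `𝕜`. -/
def Admissible (𝕜 : Type*) [RCLike 𝕜] {X : Type*} [MeasurableSpace X] (μ : Measure X)
    (θ r c : ℝ) : Prop :=
  ∀ e f : Lp 𝕜 (ENNReal.ofReal θ) μ, e ≠ 0 →
    ‖pairing μ f (fun x => nonlinearN θ e x / ((‖e‖ ^ (θ - 1) : ℝ) : 𝕜))‖ ^ r
      + c * (⨅ α : 𝕜, ‖f - α • e‖ ^ r) ≤ ‖f‖ ^ r

/-- The optimal (largest) admissible constant for `𝕜`-valued functions on `(X, μ)`. For `𝕜 = ℂ`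
this is `c*_{θ,r}`, for `𝕜 = ℝ` it is `c^{*,ℝ}_{θ,r}`. -/
def cStar (𝕜 : Type*) [RCLike 𝕜] {X : Type*} [MeasurableSpace X] (μ : Measure X)
    (θ r : ℝ) : ℝ :=
  sSup {c : ℝ | Admissible 𝕜 μ θ r c}

end SharpHolder

end

open scoped ENNReal Topology

namespace SharpHolder

/-! ### Isometries between Lebesgue spaces -/

/-! The pairing is visible to the norm alone: `θ * Re⟨f, N_θ(e)⟩` is the derivative of `‖e + t f‖ ^
θ` at `t = 0`. Hence every real-linear isometry between `L^θ`-spaces, over either field, preserves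
the real part of the pairing (`re_pairing_map`), and admissible constants `c ≥ 0` can be pulled back
along suitable embeddings.

From real to complex: embed complex `L^θ` in real `L^θ`, after rotating `f` so that its pairing is
nonnegative. The infimum over real multiples can only exceed the one over complex multiples. From
complex to real: embed and complexify; for real functions nonreal multiples do not improve the
infimum.

The embeddings combine changes of density, a measure-preserving map from an atomless space onto any
standard Borel probability space, and the fact that averaging `|Re(z ω)| ^ p` over the circle gives
a constant multiple of `|z| ^ p`.

A largest constant exists because Hölder makes `0` admissible, the choice `f = i e` bounds `c` by
`1`, and the inequality is affine in `c`. -/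

/-- A real-linear map of functions that preserves `L^p`-norms induces an isometry of `L^p`-spaces. -/
lemma exists_linearIsometry_of_eLpNorm_eq {E F X Y : Type*} [NormedAddCommGroup E]
    [NormedSpace ℝ E] [NormedAddCommGroup F] [NormedSpace ℝ F] [MeasurableSpace X]
    [MeasurableSpace Y] {μ : Measure X} {ν : Measure Y} {p : ℝ≥0∞} [hp : Fact (1 ≤ p)]
    (S : (X → E) →ₗ[ℝ] (Y → F))
    (hmeas : ∀ f, StronglyMeasurable f → AEStronglyMeasurable (S f) ν)
    (hnorm : ∀ f, StronglyMeasurable f → eLpNorm (S f) p ν = eLpNorm f p μ) :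
    Nonempty (Lp E p μ →ₗᵢ[ℝ] Lp F p ν) := by
  have hp0 : p ≠ 0 := (zero_lt_one.trans_le hp.out).ne'
  -- `S` acts on functions; applying norm preservation to `f - g` makes it well defined on
  -- almost-everywhere classes.
  have hae : ∀ f g : X → E, StronglyMeasurable f → StronglyMeasurable g → f =ᵐ[μ] g →
      S f =ᵐ[ν] S g := by
    intro f g hf hg hfg
    have h0 : eLpNorm (S (f - g)) p ν = 0 := by
      rw [hnorm _ (hf.sub hg), eLpNorm_eq_zero_iff (hf.sub hg).aestronglyMeasurable hp0]
      filter_upwards [hfg] with x hx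
      simp [hx]
    rw [eLpNorm_eq_zero_iff (hmeas _ (hf.sub hg)) hp0, map_sub] at h0
    filter_upwards [h0] with x hx
    exact sub_eq_zero.mp hx
  have hmem : ∀ f : Lp E p μ, MemLp (S f) p ν := fun f =>
    ⟨hmeas _ (Lp.stronglyMeasurable f), by
      rw [hnorm _ (Lp.stronglyMeasurable f)]; exact Lp.eLpNorm_lt_top f⟩
  refine ⟨⟨⟨⟨fun f => (hmem f).toLp _, fun f g => ?_⟩, fun c f => ?_⟩, fun f => ?_⟩⟩
  · rw [← MemLp.toLp_add, MemLp.toLp_eq_toLp_iff, ← map_add]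
    exact hae _ _ (Lp.stronglyMeasurable _)
      ((Lp.stronglyMeasurable f).add (Lp.stronglyMeasurable g)) (Lp.coeFn_add f g)
  · change _ = c • _
    rw [← MemLp.toLp_const_smul, MemLp.toLp_eq_toLp_iff, ← map_smul]
    exact hae _ _ (Lp.stronglyMeasurable _)
      ((Lp.stronglyMeasurable f).const_smul c) (Lp.coeFn_smul c f)
  · change ‖(hmem f).toLp _‖ = ‖f‖
    rw [Lp.norm_toLp, hnorm _ (Lp.stronglyMeasurable f), Lp.norm_def]

/-- Multiplication by the `p`-th root of the density embeds `L^p(μ)` into `L^p(Q)` for `μ ≪ Q`. -/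
lemma exists_linearIsometry_of_absolutelyContinuous {X : Type*} [MeasurableSpace X]
    {μ Q : Measure X} [SigmaFinite μ] [SigmaFinite Q] (h : μ ≪ Q) {p : ℝ≥0∞}
    [hp : Fact (1 ≤ p)] (hpt : p ≠ ∞) :
    Nonempty (Lp ℝ p μ →ₗᵢ[ℝ] Lp ℝ p Q) := by
  have hp0 : p ≠ 0 := (zero_lt_one.trans_le hp.out).ne'
  have hpr : 0 < p.toReal := ENNReal.toReal_pos hp0 hpt
  set w : X → ℝ := fun x => (μ.rnDeriv Q x).toReal ^ p.toReal⁻¹ with hw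
  have hwm : Measurable w := (Measure.measurable_rnDeriv μ Q).ennreal_toReal.pow_const _
  refine exists_linearIsometry_of_eLpNorm_eq
    ⟨⟨fun f x => w x * f x, fun f g => ?_⟩, fun c f => ?_⟩ (fun f hf => ?_) (fun f hf => ?_)
  · ext x; simp [mul_add]
  · ext x; simp [mul_left_comm]
  · exact (hwm.mul hf.measurable).aestronglyMeasurable
  · rw [eLpNorm_eq_lintegral_rpow_enorm_toReal hp0 hpt,
      eLpNorm_eq_lintegral_rpow_enorm_toReal hp0 hpt]
    congr 1
    conv_rhs => rw [← Measure.withDensity_rnDeriv_eq μ Q h]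
    rw [lintegral_withDensity_eq_lintegral_mul _ (Measure.measurable_rnDeriv μ Q)
      (hf.measurable.enorm.pow_const _)]
    refine lintegral_congr_ae ?_
    filter_upwards [Measure.rnDeriv_lt_top μ Q] with x hx
    have hwx : ‖w x‖ₑ ^ p.toReal = μ.rnDeriv Q x := by
      rw [Real.enorm_of_nonneg (by positivity), hw,
        ENNReal.ofReal_rpow_of_nonneg (by positivity) hpr.le,
        ← Real.rpow_mul ENNReal.toReal_nonneg, inv_mul_cancel₀ hpr.ne', Real.rpow_one,
        ENNReal.ofReal_toReal hx.ne]
    change ‖w x * f x‖ₑ ^ p.toReal = _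
    rw [enorm_mul, ENNReal.mul_rpow_of_nonneg _ _ hpr.le, hwx]
    rfl

/-- The distribution function of an atomless probability measure on the line is uniformly
distributed. -/
lemma exists_measurePreserving_unitInterval_of_real (Q : Measure ℝ) [IsProbabilityMeasure Q]
    [NullSingletonClass Q] : ∃ g : ℝ → unitInterval, MeasurePreserving g Q volume := by
  set F := ProbabilityTheory.cdf Q with hF
  have hmono : Monotone F := ProbabilityTheory.monotone_cdf Q
  have hcont : Continuous F := by
    rw [continuous_iff_continuousAt]
    intro x
    refine continuousAt_iff_continuous_left'_right'.2
      ⟨?_, (F.right_continuous x).mono Set.Ioi_subset_Ici_self⟩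
    rw [hmono.continuousWithinAt_Iio_iff_leftLim_eq]
    -- A jump of the distribution function would be an atom.
    have h1 := F.measure_singleton x
    rw [hF, ProbabilityTheory.measure_cdf, measure_singleton, eq_comm,
      ENNReal.ofReal_eq_zero] at h1
    have := hmono.leftLim_le (le_refl x)
    linarith
  have hsurj : ∀ y, 0 < y → y < 1 → ∃ t, F t = y := by
    intro y h0 h1
    refine mem_range_of_exists_le_of_exists_ge hcont ?_ ?_
    · exact ((ProbabilityTheory.tendsto_cdf_atBot Q).eventually (ge_mem_nhds h0)).exists
    · exact ((ProbabilityTheory.tendsto_cdf_atTop Q).eventually (le_mem_nhds h1)).exists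
  have hQ : ∀ t, Q (Set.Iic t) = ENNReal.ofReal (F t) := fun t =>
    (ProbabilityTheory.ofReal_cdf Q t).symm
  have hupper : ∀ x, 0 ≤ x → Q {t | F t ≤ x} ≤ ENNReal.ofReal x := by
    intro x hx0
    rcases le_or_gt 1 x with h1 | h1
    · exact prob_le_one.trans (by simpa using h1)
    -- `F` may be flat at height `x`, so one point of the fibre does not bound the sublevel set; a
    -- slightly higher level `y` does.
    have hle : ∀ y ∈ Set.Ioo x 1, Q {t | F t ≤ x} ≤ ENNReal.ofReal y := by
      intro y hy
      obtain ⟨t₀, ht₀⟩ := hsurj y (hx0.trans_lt hy.1) hy.2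
      rw [← ht₀, ← hQ]
      refine measure_mono fun t ht => ?_
      by_contra hc
      have := hmono (le_of_not_ge hc)
      have h2 : F t ≤ x := ht
      linarith [hy.1]
    have ht : Filter.Tendsto ENNReal.ofReal (𝓝[>] x) (𝓝 (ENNReal.ofReal x)) :=
      (ENNReal.continuous_ofReal.tendsto x).mono_left nhdsWithin_le_nhds
    refine ge_of_tendsto ht ?_
    filter_upwards [Ioo_mem_nhdsGT h1] with y hy using hle y hy
  have hlower : ∀ x, 0 ≤ x → x ≤ 1 → ENNReal.ofReal x ≤ Q {t | F t ≤ x} := by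
    intro x hx0 hx1
    rcases hx0.eq_or_lt with rfl | hx0
    · simp
    rcases hx1.eq_or_lt with rfl | hx1
    · rw [Set.eq_univ_of_forall (s := {t | F t ≤ 1}) fun t => ProbabilityTheory.cdf_le_one Q t]
      simp
    obtain ⟨t₀, ht₀⟩ := hsurj x hx0 hx1
    rw [← ht₀, ← hQ]
    exact measure_mono fun t ht => hmono ht
  refine ⟨fun t => ⟨F t, ProbabilityTheory.cdf_nonneg Q t, ProbabilityTheory.cdf_le_one Q t⟩,
    (hmono.measurable.subtype_mk), ?_⟩
  have hm : Measurable fun t : ℝ => (⟨F t, ProbabilityTheory.cdf_nonneg Q t,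
    ProbabilityTheory.cdf_le_one Q t⟩ : unitInterval) := hmono.measurable.subtype_mk
  have := Measure.isFiniteMeasure_map Q (fun t : ℝ => (⟨F t, ProbabilityTheory.cdf_nonneg Q t,
    ProbabilityTheory.cdf_le_one Q t⟩ : unitInterval))
  refine Measure.ext_of_Iic _ _ fun x => ?_
  rw [Measure.map_apply hm measurableSet_Iic, unitInterval.volume_Iic]
  exact le_antisymm (hupper x x.2.1) (hlower x x.2.1 x.2.2)

/-- An atomless standard Borel probability space maps onto every standard Borel probability
space. -/
lemma exists_measurePreserving {X Y : Type*} [MeasurableSpace X] [StandardBorelSpace X]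
    [MeasurableSpace Y] [StandardBorelSpace Y] (P : Measure X) [IsProbabilityMeasure P]
    (Q : Measure Y) [IsProbabilityMeasure Q] [NullSingletonClass Q] :
    ∃ φ : Y → X, MeasurePreserving φ Q P := by
  have hX : Nonempty X := nonempty_of_isProbabilityMeasure P
  -- Every standard Borel probability measure is an image of Lebesgue measure on the unit interval.
  obtain ⟨q, hq, hqP⟩ := Measure.exists_measurable_map_eq P
  have hι := measurableEmbedding_embeddingReal Y
  have : IsProbabilityMeasure (Q.map (embeddingReal Y)) :=
    Measure.isProbabilityMeasure_map hι.measurable.aemeasurable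
  have : NullSingletonClass (Q.map (embeddingReal Y)) := ⟨fun x => by
    rw [hι.map_apply]
    refine Set.Subsingleton.measure_zero (fun a ha b hb => hι.injective ?_) Q
    exact Eq.trans ha (Eq.symm hb)⟩
  obtain ⟨g, hg⟩ := exists_measurePreserving_unitInterval_of_real (Q.map (embeddingReal Y))
  exact ⟨_, (MeasurePreserving.mk hq hqP).comp (hg.comp (hι.measurable.measurePreserving Q))⟩

/-- The real `L^p`-space of an atomless standard Borel space contains that of any other standard
Borel space. -/
theorem exists_linearIsometry_real {X Y : Type*} [MeasurableSpace X] [StandardBorelSpace X]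
    [MeasurableSpace Y] [StandardBorelSpace Y] (μ : Measure X) [SigmaFinite μ]
    (ν : Measure Y) [SigmaFinite ν] [NullSingletonClass ν] (hμ : μ ≠ 0) (hν : ν ≠ 0)
    {p : ℝ≥0∞} [hp : Fact (1 ≤ p)] (hpt : p ≠ ∞) :
    Nonempty (Lp ℝ p μ →ₗᵢ[ℝ] Lp ℝ p ν) := by
  have : NeZero μ := ⟨hμ⟩
  have : NeZero ν := ⟨hν⟩
  have : NullSingletonClass ν.toFinite := ⟨fun x =>
    toFinite_absolutelyContinuous ν (measure_singleton x)⟩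
  -- Pass to equivalent probability measures, compose with a measure-preserving map there, and
  -- return to `ν`.
  obtain ⟨A⟩ := exists_linearIsometry_of_absolutelyContinuous
    (absolutelyContinuous_toFinite μ) hpt
  obtain ⟨C⟩ := exists_linearIsometry_of_absolutelyContinuous
    (toFinite_absolutelyContinuous ν) hpt
  obtain ⟨φ, hφ⟩ := exists_measurePreserving μ.toFinite ν.toFinite
  exact ⟨(C.comp (Lp.compMeasurePreservingₗᵢ ℝ φ hφ)).comp A⟩

/-! ### Complex `L^p` inside real `L^p` -/

/-- A rotation invariant measure, normalised so that `ℂ` embeds isometrically in real `L^s`. -/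
lemma exists_complex_lintegral_re_rpow (s : ℝ) (hs : 0 < s) :
    ∃ (Ω : Type) (_ : MeasurableSpace Ω) (_ : StandardBorelSpace Ω) (κ : Measure Ω)
      (_ : IsFiniteMeasure κ) (h : Ω → ℂ), Measurable h ∧
      ∀ z : ℂ, ∫⁻ ω, ‖(z * h ω).re‖ₑ ^ s ∂κ = ‖z‖ₑ ^ s := by
  let : MeasurableSpace Circle := borel Circle
  have : BorelSpace Circle := ⟨rfl⟩
  set C : ℝ≥0∞ := ∫⁻ ω : Circle, ‖(ω : ℂ).re‖ₑ ^ s ∂Measure.haar with hC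
  have hcont : Continuous fun ω : Circle => ‖(ω : ℂ).re‖ₑ ^ s :=
    (ENNReal.continuous_rpow_const).comp (by fun_prop)
  have hCtop : C ≠ ∞ := by
    refine ne_top_of_le_ne_top (measure_ne_top (Measure.haar : Measure Circle) Set.univ) ?_
    rw [← setLIntegral_one, Measure.restrict_univ]
    refine lintegral_mono fun ω => ENNReal.rpow_le_one ?_ hs.le
    rw [← ofReal_norm, ENNReal.ofReal_le_one]
    exact (Complex.abs_re_le_norm _).trans (Circle.norm_coe ω).le
  have hC0 : C ≠ 0 := by
    rw [hC, Ne, lintegral_eq_zero_iff hcont.measurable]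
    -- Haar measure charges open sets, so a continuous integrand vanishing almost everywhere would
    -- vanish at `1`.
    intro h0
    have := congrFun (Measure.eq_of_ae_eq h0 hcont continuous_zero) 1
    simp at this
  refine ⟨Circle, inferInstance, inferInstance, C⁻¹ • Measure.haar,
    Measure.smul_finite _ (ENNReal.inv_ne_top.2 hC0), fun ω => ω,
    (show Continuous fun ω : Circle => (ω : ℂ) by fun_prop).measurable, fun z => ?_⟩
  -- The argument of `z` is a rotation, which Haar measure absorbs.
  have hz : ∀ ω : Circle, ‖(z * ω).re‖ₑ ^ s
      = ‖z‖ₑ ^ s * ‖((Circle.exp z.arg * ω : Circle) : ℂ).re‖ₑ ^ s := by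
    intro ω
    rw [← ENNReal.mul_rpow_of_nonneg _ _ hs.le]
    congr 1
    have h1 : (z * ω).re = ‖z‖ * ((Circle.exp z.arg * ω : Circle) : ℂ).re := by
      conv_lhs => rw [← Complex.norm_mul_exp_arg_mul_I z]
      rw [mul_assoc, Complex.re_ofReal_mul, Circle.coe_mul, Circle.coe_exp]
    rw [h1, enorm_mul, enorm_norm]
  rw [lintegral_smul_measure]
  simp_rw [hz]
  rw [lintegral_const_mul' _ _ (ENNReal.rpow_ne_top_of_nonneg hs.le enorm_ne_top),
    lintegral_mul_left_eq_self (fun ω : Circle => ‖(ω : ℂ).re‖ₑ ^ s) (Circle.exp z.arg),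
    smul_eq_mul, mul_comm, mul_assoc, ENNReal.mul_inv_cancel hC0 hCtop, mul_one]

/-- Complex `L^p`-spaces embed in real ones. -/
theorem exists_linearIsometry_complex_real {X Y : Type*} [MeasurableSpace X] [StandardBorelSpace X]
    [MeasurableSpace Y] [StandardBorelSpace Y] (μ : Measure X) [SigmaFinite μ]
    (ν : Measure Y) [SigmaFinite ν] [NullSingletonClass ν] (hμ : μ ≠ 0) (hν : ν ≠ 0)
    {p : ℝ≥0∞} [hp : Fact (1 ≤ p)] (hpt : p ≠ ∞) :
    Nonempty (Lp ℂ p μ →ₗᵢ[ℝ] Lp ℝ p ν) := by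
  have hp0 : p ≠ 0 := (zero_lt_one.trans_le hp.out).ne'
  have hpr : 0 < p.toReal := ENNReal.toReal_pos hp0 hpt
  obtain ⟨Ω, _, _, κ, _, h, hm, hκ⟩ := exists_complex_lintegral_re_rpow p.toReal hpr
  have hκ0 : κ ≠ 0 := by
    rintro rfl
    simpa using hκ 1
  obtain ⟨B⟩ := exists_linearIsometry_real (μ.prod κ) ν
    (by
      rw [Ne, ← Measure.measure_univ_eq_zero, ← Set.univ_prod_univ, Measure.prod_prod]
      simp [hμ, hκ0]) hν hpt
  have hjoint : ∀ f : X → ℂ, StronglyMeasurable f →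
      Measurable fun z : X × Ω => (f z.1 * h z.2).re := fun f hf =>
    Complex.measurable_re.comp
      ((hf.measurable.comp measurable_fst).mul (hm.comp measurable_snd))
  obtain ⟨A⟩ := exists_linearIsometry_of_eLpNorm_eq (μ := μ) (ν := μ.prod κ) (p := p)
    (⟨⟨fun f z => (f z.1 * h z.2).re, fun f g => by ext x; simp [add_mul]⟩,
      fun c f => by ext x; simp; ring⟩ : (X → ℂ) →ₗ[ℝ] (X × Ω → ℝ))
    (fun f hf => (hjoint f hf).aestronglyMeasurable) (fun f hf => by
      rw [eLpNorm_eq_lintegral_rpow_enorm_toReal hp0 hpt,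
        eLpNorm_eq_lintegral_rpow_enorm_toReal hp0 hpt]
      congr 1
      change ∫⁻ z : X × Ω, ‖(f z.1 * h z.2).re‖ₑ ^ p.toReal ∂_ = _
      rw [lintegral_prod _ ((hjoint f hf).enorm.pow_const _).aemeasurable]
      exact lintegral_congr fun x => hκ (f x))
  exact ⟨B.comp A⟩

/-- Complexification followed by an isometry of real `L^p`-spaces. -/
lemma exists_linearIsometry_real_complex {X Y : Type*} [MeasurableSpace X] [StandardBorelSpace X]
    [MeasurableSpace Y] [StandardBorelSpace Y] (μ : Measure X) [SigmaFinite μ]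
    (ν : Measure Y) [SigmaFinite ν] [NullSingletonClass ν] (hμ : μ ≠ 0) (hν : ν ≠ 0)
    {p : ℝ≥0∞} [hp : Fact (1 ≤ p)] (hpt : p ≠ ∞) :
    ∃ T : Lp ℝ p μ →ₗᵢ[ℝ] Lp ℂ p ν, ∀ (f e : Lp ℝ p μ) (α : ℂ),
      ‖T f - (α.re : ℂ) • T e‖ ≤ ‖T f - α • T e‖ := by
  obtain ⟨B⟩ := exists_linearIsometry_real μ ν hμ hν hpt
  have hco : ∀ f : Lp ℝ p ν, ⇑((Complex.ofRealCLM).compLpL p ν f) =ᵐ[ν] fun x => (f x : ℂ) :=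
    fun f => Complex.ofRealCLM.coeFn_compLpL f
  let J : Lp ℝ p ν →ₗᵢ[ℝ] Lp ℂ p ν :=
    ⟨((Complex.ofRealCLM).compLpL p ν : Lp ℝ p ν →L[ℝ] Lp ℂ p ν), fun f => by
      refine le_antisymm (Lp.norm_le_norm_of_ae_le ?_) (Lp.norm_le_norm_of_ae_le ?_) <;>
      · filter_upwards [hco f] with x hx
        simp [hx]⟩
  have hJ : ∀ f : Lp ℝ p ν, ⇑(J f) =ᵐ[ν] fun x => (f x : ℂ) := hco
  refine ⟨J.comp B, fun f e α => Lp.norm_le_norm_of_ae_le ?_⟩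
  filter_upwards [hJ (B f), hJ (B e), Lp.coeFn_sub (J (B f)) ((α.re : ℂ) • J (B e)),
    Lp.coeFn_sub (J (B f)) (α • J (B e)), Lp.coeFn_smul (α.re : ℂ) (J (B e)),
    Lp.coeFn_smul α (J (B e))] with x h1 h2 h3 h4 h5 h6
  change ‖(J (B f) - (α.re : ℂ) • J (B e) : Lp ℂ p ν) x‖ ≤ ‖(J (B f) - α • J (B e) : Lp ℂ p ν) x‖
  rw [h3, h4, Pi.sub_apply, Pi.sub_apply, h5, h6, Pi.smul_apply, Pi.smul_apply, h1, h2]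
  simp only [smul_eq_mul]
  rw [← Complex.ofReal_mul, ← Complex.ofReal_sub, Complex.norm_real]
  -- For real `u`, `v`, the number `u - (Re α) v` is the real part of `u - α v`.
  refine le_trans (le_of_eq ?_) (Complex.abs_re_le_norm _)
  simp

/-! ### The pairing as a derivative of the norm -/

section

variable {𝕜 : Type*} [RCLike 𝕜] {X : Type*} [MeasurableSpace X] {μ : Measure X} {θ : ℝ}

lemma norm_rpow_eq_integral (hθ : 0 < θ) (f : Lp 𝕜 (ENNReal.ofReal θ) μ) :
    ‖f‖ ^ θ = ∫ x, ‖f x‖ ^ θ ∂μ := by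
  have h0 : ENNReal.ofReal θ ≠ 0 := by simpa using hθ
  have hint : 0 ≤ ∫ x, ‖f x‖ ^ θ ∂μ := integral_nonneg fun x => by positivity
  rw [Lp.norm_def, (Lp.memLp f).eLpNorm_eq_integral_rpow_norm h0 ENNReal.ofReal_ne_top,
    ENNReal.toReal_ofReal hθ.le, ENNReal.toReal_ofReal (by positivity),
    ← Real.rpow_mul hint, inv_mul_cancel₀ hθ.ne', Real.rpow_one]

lemma integrable_norm_rpow (hθ : 0 < θ) {f : X → 𝕜} (hf : MemLp f (ENNReal.ofReal θ) μ) :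
    Integrable (fun x => ‖f x‖ ^ θ) μ := by
  have h0 : ENNReal.ofReal θ ≠ 0 := by simpa using hθ
  have := hf.integrable_norm_rpow h0 ENNReal.ofReal_ne_top
  rwa [ENNReal.toReal_ofReal hθ.le] at this

lemma hasDerivAt_norm_add_smul_rpow (hθ : 1 < θ) (a b : 𝕜) (t : ℝ) :
    HasDerivAt (fun t : ℝ => ‖a + t • b‖ ^ θ)
      (θ * ‖a + t • b‖ ^ (θ - 2) * inner ℝ (a + t • b) b) t := by
  have h1 : HasDerivAt (fun t : ℝ => a + t • b) b t := by
    simpa using ((hasDerivAt_id t).smul_const b).const_add a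
  exact (hasFDerivAt_norm_rpow (a + t • b) hθ).comp_hasDerivAt t h1

lemma norm_nonlinearN (hθ : 1 < θ) (h : X → 𝕜) (x : X) :
    ‖nonlinearN θ h x‖ = ‖h x‖ ^ (θ - 1) := by
  unfold nonlinearN
  split_ifs with h0
  · rw [h0, norm_zero, Real.zero_rpow (by linarith)]
  · have hpos : 0 < ‖h x‖ := norm_pos_iff.2 h0
    rw [norm_mul, RCLike.norm_ofReal, abs_of_nonneg (by positivity)]
    nth_rewrite 2 [← Real.rpow_one ‖h x‖]
    rw [← Real.rpow_add hpos]
    ring_nf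

lemma aestronglyMeasurable_nonlinearN (h : X → 𝕜) (hh : StronglyMeasurable h) :
    AEStronglyMeasurable (nonlinearN θ h) μ := by
  have hm := hh.measurable
  refine (Measurable.ite (hm (measurableSet_singleton 0)) measurable_const ?_).aestronglyMeasurable
  exact (RCLike.measurable_ofReal.comp (hm.norm.pow_const _)).mul hm

lemma mul_rpow_sub_one_le {u v : ℝ} (hθ : 1 < θ) (hu : 0 ≤ u) (hv : 0 ≤ v) :
    v * u ^ (θ - 1) ≤ (u + v) ^ θ := by
  rcases (add_nonneg hu hv).eq_or_lt with h | h
  · have : v = 0 := by linarith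
    rw [this, zero_mul]
    positivity
  calc v * u ^ (θ - 1) ≤ (u + v) * (u + v) ^ (θ - 1) := by
        gcongr <;> linarith
    _ = (u + v) ^ θ := by
        rw [mul_comm, ← Real.rpow_add_one h.ne']; ring_nf

lemma integrable_norm_add_norm_rpow (hθ : 1 < θ) (e f : Lp 𝕜 (ENNReal.ofReal θ) μ) :
    Integrable (fun x => (‖e x‖ + ‖f x‖) ^ θ) μ := by
  have := integrable_norm_rpow (by linarith : 0 < θ) ((Lp.memLp e).norm.add (Lp.memLp f).norm)
  refine this.congr (Filter.Eventually.of_forall fun x => ?_)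
  simp only [Pi.add_apply, Real.norm_eq_abs]
  rw [abs_of_nonneg (by positivity)]

lemma integrable_pairing_nonlinearN (hθ : 1 < θ) (e f : Lp 𝕜 (ENNReal.ofReal θ) μ) :
    Integrable (fun x => f x * (starRingEnd 𝕜) (nonlinearN θ e x)) μ := by
  refine (integrable_norm_add_norm_rpow hθ e f).mono'
    ((Lp.aestronglyMeasurable f).mul (RCLike.continuous_conj.comp_aestronglyMeasurable
      (aestronglyMeasurable_nonlinearN _ (Lp.stronglyMeasurable e))))
    (Filter.Eventually.of_forall fun x => ?_)
  rw [norm_mul, RCLike.norm_conj, norm_nonlinearN hθ]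
  exact mul_rpow_sub_one_le hθ (norm_nonneg _) (norm_nonneg _)

lemma re_mul_conj_nonlinearN (e f : X → 𝕜) (x : X) :
    RCLike.re (f x * (starRingEnd 𝕜) (nonlinearN θ e x))
      = ‖e x‖ ^ (θ - 2) * inner ℝ (e x) (f x) := by
  unfold nonlinearN
  split_ifs with h0
  · simp [h0]
  · rw [map_mul (starRingEnd 𝕜), RCLike.conj_ofReal, mul_left_comm, RCLike.re_ofReal_mul,
      real_inner_eq_re_inner 𝕜,
      RCLike.inner_apply]

/-- Differentiation under the integral sign; this expresses the real part of the pairing through the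
norm and the real-linear structure only. -/
theorem hasDerivAt_norm_rpow_pairing [Fact (1 ≤ ENNReal.ofReal θ)] (hθ : 1 < θ)
    (e f : Lp 𝕜 (ENNReal.ofReal θ) μ) :
    HasDerivAt (fun t : ℝ => ‖e + t • f‖ ^ θ)
      (θ * RCLike.re (pairing μ f (nonlinearN θ e))) 0 := by
  have hθ0 : 0 < θ := by linarith
  have hrepr : ∀ t : ℝ, ‖e + t • f‖ ^ θ = ∫ x, ‖e x + t • f x‖ ^ θ ∂μ := by
    intro t
    rw [norm_rpow_eq_integral hθ0]
    refine integral_congr_ae ?_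
    filter_upwards [Lp.coeFn_add e (t • f), Lp.coeFn_smul t f] with x h1 h2
    rw [h1, Pi.add_apply, h2, Pi.smul_apply]
  have hpair : θ * RCLike.re (pairing μ f (nonlinearN θ e))
      = ∫ x, θ * ‖e x + (0 : ℝ) • f x‖ ^ (θ - 2) * inner ℝ (e x + (0 : ℝ) • f x) (f x) ∂μ := by
    rw [pairing, ← integral_re (integrable_pairing_nonlinearN hθ e f), ← integral_const_mul]
    simp_rw [zero_smul, add_zero, mul_assoc, re_mul_conj_nonlinearN]
  have he := (Lp.stronglyMeasurable e)
  have hf := (Lp.stronglyMeasurable f)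
  simp_rw [hrepr]
  rw [hpair]
  refine (hasDerivAt_integral_of_dominated_loc_of_deriv_le (Metric.ball_mem_nhds (0 : ℝ) one_pos)
    -- For `|t| ≤ 1` the norm of `e + t f` is at most `‖e‖ + ‖f‖`; the extra `‖f‖` absorbs the
    -- factor left by Cauchy–Schwarz, via `mul_rpow_sub_one_le`.
    (bound := fun x => θ * (‖e x‖ + ‖f x‖ + ‖f x‖) ^ θ)
    (F' := fun t x => θ * ‖e x + t • f x‖ ^ (θ - 2) * inner ℝ (e x + t • f x) (f x))
    (Filter.Eventually.of_forall fun t => ?_) ?_ ?_ ?_ ?_ ?_).2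
  · exact ((he.add (hf.const_smul t)).measurable.norm.pow_const _).aestronglyMeasurable
  · simpa using integrable_norm_rpow hθ0 (Lp.memLp e)
  · have hm := (he.add (hf.const_smul (0 : ℝ)))
    exact ((((hm.measurable.norm.pow_const _).const_mul θ).aestronglyMeasurable).mul
      (hm.aestronglyMeasurable.inner hf.aestronglyMeasurable))
  · refine Filter.Eventually.of_forall fun x t ht => ?_
    have ht1 : |t| ≤ 1 := by simpa using (Metric.mem_ball.1 ht).le
    set z := e x + t • f x with hz
    have hzn : ‖z‖ ≤ ‖e x‖ + ‖f x‖ := by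
      refine (norm_add_le _ _).trans ?_
      rw [norm_smul, Real.norm_eq_abs]
      have := mul_le_mul_of_nonneg_right ht1 (norm_nonneg (f x))
      linarith
    rw [mul_assoc, norm_mul, Real.norm_of_nonneg hθ0.le]
    refine mul_le_mul_of_nonneg_left ?_ hθ0.le
    rw [norm_mul, Real.norm_of_nonneg (by positivity)]
    calc ‖z‖ ^ (θ - 2) * ‖(inner ℝ z (f x) : ℝ)‖ ≤ ‖z‖ ^ (θ - 2) * (‖z‖ * ‖f x‖) := by
          gcongr
          exact norm_inner_le_norm _ _
      _ ≤ ‖f x‖ * ‖z‖ ^ (θ - 1) := by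
          -- `θ - 2` may be negative, so `z = 0` is treated apart.
          rcases (norm_nonneg z).eq_or_lt with h | h
          · rw [← h, zero_mul, mul_zero]
            positivity
          · rw [show θ - 1 = θ - 2 + 1 by ring, Real.rpow_add_one h.ne']
            exact le_of_eq (by ring)
      _ ≤ ‖f x‖ * (‖e x‖ + ‖f x‖) ^ (θ - 1) := by
          gcongr
      _ ≤ (‖e x‖ + ‖f x‖ + ‖f x‖) ^ θ :=
          mul_rpow_sub_one_le hθ (by positivity) (norm_nonneg _)
  · refine Integrable.const_mul ?_ θ
    have := integrable_norm_rpow hθ0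
      (((Lp.memLp e).norm.add (Lp.memLp f).norm).add (Lp.memLp f).norm)
    refine this.congr (Filter.Eventually.of_forall fun x => ?_)
    simp only [Pi.add_apply, Real.norm_eq_abs]
    rw [abs_of_nonneg (by positivity)]
  · exact Filter.Eventually.of_forall fun x t _ => hasDerivAt_norm_add_smul_rpow hθ _ _ t

/-- Real-linear isometries preserve the real part of the pairing `⟨f, N_θ(e)⟩`. -/
theorem re_pairing_map [Fact (1 ≤ ENNReal.ofReal θ)] (hθ : 1 < θ) {𝕜' : Type*} [RCLike 𝕜']
    {Y : Type*} [MeasurableSpace Y] {ν : Measure Y}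
    (T : Lp 𝕜 (ENNReal.ofReal θ) μ →ₗᵢ[ℝ] Lp 𝕜' (ENNReal.ofReal θ) ν)
    (e f : Lp 𝕜 (ENNReal.ofReal θ) μ) :
    RCLike.re (pairing ν (T f) (nonlinearN θ (T e)))
      = RCLike.re (pairing μ f (nonlinearN θ e)) := by
  have h1 := hasDerivAt_norm_rpow_pairing hθ e f
  have h2 := hasDerivAt_norm_rpow_pairing hθ (T e) (T f)
  have h3 : (fun t : ℝ => ‖T e + t • T f‖ ^ θ) = fun t : ℝ => ‖e + t • f‖ ^ θ := by
    ext t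
    rw [← map_smul, ← map_add, T.norm_map]
  rw [h3] at h2
  exact mul_left_cancel₀ (by linarith) (h2.unique h1)

lemma pairing_div (f g : X → 𝕜) (c : ℝ) :
    pairing μ f (fun x => g x / (c : 𝕜)) = pairing μ f g / (c : 𝕜) := by
  unfold pairing
  simp_rw [map_div₀, RCLike.conj_ofReal, div_eq_mul_inv, ← mul_assoc]
  exact integral_mul_const _ _

lemma pairing_smul_left {p : ℝ≥0∞} (c : 𝕜) (f : Lp 𝕜 p μ) (g : X → 𝕜) :
    pairing μ (c • f : Lp 𝕜 p μ) g = c * pairing μ f g := by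
  unfold pairing
  rw [← integral_const_mul]
  refine integral_congr_ae ?_
  filter_upwards [Lp.coeFn_smul c f] with x hx
  rw [hx, Pi.smul_apply, smul_eq_mul, mul_assoc]

/-- Every scalar can be rotated to its modulus. -/
lemma exists_norm_eq_one_mul_eq_norm (z : 𝕜) : ∃ u : 𝕜, ‖u‖ = 1 ∧ u * z = (‖z‖ : 𝕜) := by
  rcases eq_or_ne z 0 with rfl | hz
  · exact ⟨1, by simp, by simp⟩
  · have hn : (‖z‖ : 𝕜) ≠ 0 := by simpa using hz
    refine ⟨(starRingEnd 𝕜) z / ‖z‖, by simp [hz], ?_⟩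
    rw [div_mul_eq_mul_div, RCLike.conj_mul, pow_two, mul_div_cancel_right₀ _ hn]

/-- Hölder's inequality obtained from the triangle inequality: `‖e + t f‖ ^ θ` and `(‖e‖ + t ‖f‖) ^
θ` agree at `t = 0` and are ordered for `t > 0`, so their derivatives at `0` are ordered. -/
theorem re_pairing_nonlinearN_le [Fact (1 ≤ ENNReal.ofReal θ)] (hθ : 1 < θ)
    (e f : Lp 𝕜 (ENNReal.ofReal θ) μ) (he : e ≠ 0) :
    RCLike.re (pairing μ f (nonlinearN θ e)) ≤ ‖e‖ ^ (θ - 1) * ‖f‖ := by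
  have hpos : 0 < ‖e‖ := norm_pos_iff.2 he
  have h1 := hasDerivAt_norm_rpow_pairing hθ e f
  have h2 : HasDerivAt (fun t : ℝ => (‖e‖ + t * ‖f‖) ^ θ) (θ * (‖e‖ ^ (θ - 1) * ‖f‖)) 0 := by
    have h3 : HasDerivAt (fun t : ℝ => ‖e‖ + t * ‖f‖) ‖f‖ 0 := by
      simpa using ((hasDerivAt_id (0 : ℝ)).mul_const ‖f‖).const_add ‖e‖
    have := h3.rpow_const (p := θ) (Or.inr hθ.le)
    convert this using 1
    simp only [zero_mul, add_zero]
    ring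
  have h4 := (h2.sub h1).hasDerivWithinAt (s := Set.Ici 0)
  have h5 : 0 ≤ θ * (‖e‖ ^ (θ - 1) * ‖f‖) - θ * RCLike.re (pairing μ f (nonlinearN θ e)) := by
    rw [hasDerivWithinAt_iff_tendsto_slope] at h4
    have hne : (𝓝[Set.Ici (0 : ℝ) \ {0}] 0).NeBot := by
      rw [Set.Ici_sdiff_left]; infer_instance
    refine ge_of_tendsto h4 ?_
    filter_upwards [self_mem_nhdsWithin] with t ht
    have ht0 : 0 < t := lt_of_le_of_ne ht.1 (Ne.symm ht.2)
    have hle : ‖e + t • f‖ ^ θ ≤ (‖e‖ + t * ‖f‖) ^ θ := by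
      refine Real.rpow_le_rpow (norm_nonneg _) ((norm_add_le _ _).trans ?_) (by linarith)
      rw [norm_smul, Real.norm_of_nonneg ht0.le]
    rw [slope_def_field]
    simp only [Pi.sub_apply, zero_smul, zero_mul, add_zero, sub_self, sub_zero]
    exact div_nonneg (by linarith) ht0.le
  have h6 : 0 ≤ θ * (‖e‖ ^ (θ - 1) * ‖f‖ - RCLike.re (pairing μ f (nonlinearN θ e))) := by
    linarith
  linarith [nonneg_of_mul_nonneg_right h6 (by linarith)]

theorem norm_pairing_nonlinearN_le [Fact (1 ≤ ENNReal.ofReal θ)] (hθ : 1 < θ)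
    (e f : Lp 𝕜 (ENNReal.ofReal θ) μ) (he : e ≠ 0) :
    ‖pairing μ f (nonlinearN θ e)‖ ≤ ‖e‖ ^ (θ - 1) * ‖f‖ := by
  obtain ⟨u, hu, hmul⟩ := exists_norm_eq_one_mul_eq_norm (pairing μ f (nonlinearN θ e))
  have := re_pairing_nonlinearN_le hθ e (u • f) he
  rwa [pairing_smul_left, hmul, RCLike.ofReal_re, norm_smul, hu, one_mul] at this

end

/-! ### Admissible constants -/

section

variable {𝕜 : Type*} [RCLike 𝕜] {X : Type*} [MeasurableSpace X] {μ : Measure X} {θ r c : ℝ}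
  [Fact (1 ≤ ENNReal.ofReal θ)]

/-- Admissibility with the normalisation taken out of the pairing. -/
lemma admissible_iff :
    Admissible 𝕜 μ θ r c ↔ ∀ e f : Lp 𝕜 (ENNReal.ofReal θ) μ, e ≠ 0 →
      (‖pairing μ f (nonlinearN θ e)‖ / ‖e‖ ^ (θ - 1)) ^ r
        + c * (⨅ α : 𝕜, ‖f - α • e‖ ^ r) ≤ ‖f‖ ^ r := by
  unfold Admissible
  refine forall_congr' fun e => forall_congr' fun f => imp_congr_right fun _ => ?_
  rw [pairing_div, norm_div, RCLike.norm_ofReal,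
    abs_of_nonneg (Real.rpow_nonneg (norm_nonneg e) _)]

lemma iInf_norm_sub_smul_nonneg (e f : Lp 𝕜 (ENNReal.ofReal θ) μ) :
    0 ≤ ⨅ α : 𝕜, ‖f - α • e‖ ^ r :=
  Real.iInf_nonneg fun _ => by positivity

lemma bddBelow_norm_sub_smul (e f : Lp 𝕜 (ENNReal.ofReal θ) μ) :
    BddBelow (Set.range fun α : 𝕜 => ‖f - α • e‖ ^ r) :=
  ⟨0, by rintro _ ⟨α, rfl⟩; positivity⟩

/-- For `c ≤ 0` the distance term only helps and Hölder suffices. This covers the sign for which the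
transfer of infima fails. -/
lemma admissible_of_nonpos (hθ : 1 < θ) (hr : 0 < r) (hc : c ≤ 0) : Admissible 𝕜 μ θ r c := by
  rw [admissible_iff]
  intro e f he
  have hpos : 0 < ‖e‖ := norm_pos_iff.2 he
  have h1 : (‖pairing μ f (nonlinearN θ e)‖ / ‖e‖ ^ (θ - 1)) ^ r ≤ ‖f‖ ^ r := by
    refine Real.rpow_le_rpow (by positivity) ?_ hr.le
    rw [div_le_iff₀' (by positivity)]
    exact norm_pairing_nonlinearN_le hθ e f he
  have h2 := mul_nonpos_of_nonpos_of_nonneg hc (iInf_norm_sub_smul_nonneg (r := r) e f)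
  linarith

lemma ofReal_smul_Lp {p : ℝ≥0∞} (a : ℝ) (e : Lp ℂ p μ) : (a : ℂ) • e = a • e :=
  algebraMap_smul ℂ a e

/-- Nonnegative real-admissible constants are admissible for complex functions whenever the complex
space embeds in the real one. -/
lemma Admissible.complex_of_real (hθ : 1 < θ) (hc : 0 ≤ c)
    {Y : Type*} [MeasurableSpace Y] {ν : Measure Y}
    (T : Lp ℂ (ENNReal.ofReal θ) ν →ₗᵢ[ℝ] Lp ℝ (ENNReal.ofReal θ) μ)
    (h : Admissible ℝ μ θ r c) : Admissible ℂ ν θ r c := by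
  rw [admissible_iff] at h ⊢
  intro e f he
  obtain ⟨u, hu, hmul⟩ := exists_norm_eq_one_mul_eq_norm (pairing ν f (nonlinearN θ e))
  have hu0 : u ≠ 0 := by rintro rfl; simp at hu
  have hTe : T e ≠ 0 := (map_ne_zero_iff T T.injective).2 he
  have hpair : pairing μ (T (u • f)) (nonlinearN θ (T e)) = ‖pairing ν f (nonlinearN θ e)‖ := by
    have := re_pairing_map hθ T e (u • f)
    rw [pairing_smul_left, hmul, RCLike.ofReal_re] at this
    exact this
  have hinf : (⨅ α : ℂ, ‖f - α • e‖ ^ r) ≤ ⨅ α : ℝ, ‖T (u • f) - α • T e‖ ^ r := by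
    -- Undoing the rotation turns the real multiple `α` into the complex multiple `u⁻¹ α`.
    refine le_ciInf fun α => (ciInf_le (bddBelow_norm_sub_smul e f) (u⁻¹ * α)).trans_eq ?_
    rw [← map_smul, ← map_sub, T.norm_map]
    have : u • f - α • e = u • (f - (u⁻¹ * α) • e) := by
      rw [smul_sub, smul_smul, mul_inv_cancel_left₀ hu0, ofReal_smul_Lp]
    rw [this, norm_smul, hu, one_mul]
  have := h (T e) (T (u • f)) hTe
  rw [hpair, T.norm_map, T.norm_map, norm_norm, norm_smul, hu, one_mul] at this
  linarith [mul_le_mul_of_nonneg_left hinf hc]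

/-- By `hT` complex multiples approximate no better than real ones, and the modulus of the complex
pairing dominates its real part, which `T` preserves. -/
lemma Admissible.real_of_complex (hθ : 1 < θ) (hr : 0 < r) (hc : 0 ≤ c)
    {Y : Type*} [MeasurableSpace Y] {ν : Measure Y}
    (T : Lp ℝ (ENNReal.ofReal θ) μ →ₗᵢ[ℝ] Lp ℂ (ENNReal.ofReal θ) ν)
    (hT : ∀ (f e : Lp ℝ (ENNReal.ofReal θ) μ) (α : ℂ),
      ‖T f - (α.re : ℂ) • T e‖ ≤ ‖T f - α • T e‖)
    (h : Admissible ℂ ν θ r c) : Admissible ℝ μ θ r c := by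
  rw [admissible_iff] at h ⊢
  intro e f he
  have hpos : 0 < ‖e‖ := norm_pos_iff.2 he
  have hTe : T e ≠ 0 := (map_ne_zero_iff T T.injective).2 he
  have hpair : ‖pairing μ f (nonlinearN θ e)‖ ≤ ‖pairing ν (T f) (nonlinearN θ (T e))‖ := by
    have h1 := re_pairing_map hθ T e f
    have h2 := RCLike.abs_re_le_norm (pairing ν (T f) (nonlinearN θ (T e)))
    rw [h1] at h2
    exact h2
  have hinf : (⨅ α : ℝ, ‖f - α • e‖ ^ r) ≤ ⨅ α : ℂ, ‖T f - α • T e‖ ^ r := by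
    refine le_ciInf fun α => (ciInf_le (bddBelow_norm_sub_smul e f) α.re).trans ?_
    refine Real.rpow_le_rpow (norm_nonneg _) ?_ hr.le
    refine le_trans (le_of_eq ?_) (hT f e α)
    rw [ofReal_smul_Lp, ← map_smul, ← map_sub, T.norm_map]
  have := h (T e) (T f) hTe
  rw [T.norm_map, T.norm_map] at this
  have h3 : (‖pairing μ f (nonlinearN θ e)‖ / ‖e‖ ^ (θ - 1)) ^ r
      ≤ (‖pairing ν (T f) (nonlinearN θ (T e))‖ / ‖e‖ ^ (θ - 1)) ^ r := by
    gcongr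
  linarith [mul_le_mul_of_nonneg_left hinf hc]

/-- If `L^θ(μ; ℝ)` contains a nontrivial complex `L^θ`-space then admissible constants are at most
one. -/
lemma Admissible.le_one (hr : 0 < r) {Y : Type*} [MeasurableSpace Y] {ν : Measure Y}
    (T : Lp ℂ (ENNReal.ofReal θ) ν →ₗᵢ[ℝ] Lp ℝ (ENNReal.ofReal θ) μ)
    {e : Lp ℂ (ENNReal.ofReal θ) ν} (he : e ≠ 0) (h : Admissible ℝ μ θ r c) : c ≤ 1 := by
  by_contra! hc
  rw [admissible_iff] at h
  have hpos : 0 < ‖e‖ := norm_pos_iff.2 he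
  have hinf : ‖e‖ ^ r ≤ ⨅ α : ℝ, ‖T (Complex.I • e) - α • T e‖ ^ r := by
    refine le_ciInf fun α => Real.rpow_le_rpow hpos.le ?_ hr.le
    rw [← map_smul, ← map_sub, T.norm_map, ← ofReal_smul_Lp, ← sub_smul, norm_smul]
    refine le_mul_of_one_le_left hpos.le ?_
    -- The distance from `i` to the real line is at least `1`.
    simpa using Complex.abs_im_le_norm (Complex.I - α)
  have := h (T e) (T (Complex.I • e)) ((map_ne_zero_iff T T.injective).2 he)
  rw [T.norm_map, T.norm_map, norm_smul, Complex.norm_I, one_mul] at this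
  have h1 : 0 ≤ (‖pairing μ (T (Complex.I • e)) (nonlinearN θ (T e))‖ / ‖e‖ ^ (θ - 1)) ^ r := by
    positivity
  have h2 : 0 < ‖e‖ ^ r := by positivity
  nlinarith

/-- The supremum of the admissible constants is admissible. -/
lemma isGreatest_cStar (hθ : 1 < θ) (hr : 0 < r)
    (hb : BddAbove {c : ℝ | Admissible 𝕜 μ θ r c}) :
    IsGreatest {c : ℝ | Admissible 𝕜 μ θ r c} (cStar 𝕜 μ θ r) := by
  refine ⟨fun e f he => ?_, fun c hc => le_csSup hb hc⟩
  have hne : ({c : ℝ | Admissible 𝕜 μ θ r c}).Nonempty := ⟨0, admissible_of_nonpos hθ hr le_rfl⟩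
  -- If the infimum vanishes, `c` plays no role; otherwise each pair `e, f` is just an upper bound
  -- on `c`, inherited by the supremum.
  rcases (iInf_norm_sub_smul_nonneg (r := r) e f).eq_or_lt with h0 | h0
  · have := admissible_of_nonpos hθ hr (le_refl (0 : ℝ)) e f he
    rw [← h0, mul_zero] at this ⊢
    exact this
  · rw [← le_sub_iff_add_le', ← le_div_iff₀ h0]
    refine csSup_le hne fun c hc => ?_
    rw [le_div_iff₀ h0, le_sub_iff_add_le']
    exact hc e f he

end

lemma exists_Lp_ne_zero {X : Type*} [MeasurableSpace X] (μ : Measure X) [SigmaFinite μ]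
    (hμ : μ ≠ 0) (p : ℝ≥0∞) : ∃ e : Lp ℂ p μ, e ≠ 0 := by
  obtain ⟨n, hn⟩ : ∃ n, μ (spanningSets μ n) ≠ 0 := by
    by_contra! h
    apply hμ
    rw [← Measure.measure_univ_eq_zero, ← iUnion_spanningSets μ]
    exact measure_iUnion_null h
  refine ⟨indicatorConstLp p (measurableSet_spanningSets μ n)
    (measure_spanningSets_lt_top μ n).ne 1, fun h => ?_⟩
  have h1 := (indicatorConstLp_coeFn (p := p) (hs := measurableSet_spanningSets μ n)
    (hμs := (measure_spanningSets_lt_top μ n).ne) (c := (1 : ℂ)))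
  rw [h] at h1
  apply hn
  have h2 : ∀ᵐ x ∂μ, x ∉ spanningSets μ n := by
    filter_upwards [h1, Lp.coeFn_zero ℂ p μ] with x hx hx0 hmem
    rw [hx0] at hx
    simp [hmem] at hx
  simpa [ae_iff] using h2

end SharpHolder

theorem proposition1p16 (θ r : ℝ) (hθ : 1 < θ) (hr : 0 < r)
    {X : Type*} [MeasurableSpace X] [StandardBorelSpace X]
    (μ : MeasureTheory.Measure X) [MeasureTheory.SigmaFinite μ] [MeasureTheory.NullSingletonClass μ]
    (hμ : μ ≠ 0)
    {Y : Type*} [MeasurableSpace Y] [StandardBorelSpace Y]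
    (ν : MeasureTheory.Measure Y) [MeasureTheory.SigmaFinite ν] [MeasureTheory.NullSingletonClass ν]
    (hν : ν ≠ 0) :
    IsGreatest {c : ℝ | SharpHolder.Admissible ℝ μ θ r c} (SharpHolder.cStar ℝ μ θ r) ∧
    IsGreatest {c : ℝ | SharpHolder.Admissible ℂ ν θ r c} (SharpHolder.cStar ℂ ν θ r) ∧
    SharpHolder.cStar ℝ μ θ r = SharpHolder.cStar ℂ ν θ r := by
  have : Fact (1 ≤ ENNReal.ofReal θ) := ⟨by simpa using hθ.le⟩
  obtain ⟨T⟩ := SharpHolder.exists_linearIsometry_complex_real ν μ hν hμ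
    (p := ENNReal.ofReal θ) ENNReal.ofReal_ne_top
  obtain ⟨S, hS⟩ := SharpHolder.exists_linearIsometry_real_complex μ ν hμ hν
    (p := ENNReal.ofReal θ) ENNReal.ofReal_ne_top
  have heq : {c : ℝ | SharpHolder.Admissible ℝ μ θ r c}
      = {c : ℝ | SharpHolder.Admissible ℂ ν θ r c} := by
    ext c
    rcases le_total c 0 with hc | hc
    · exact iff_of_true (SharpHolder.admissible_of_nonpos hθ hr hc)
        (SharpHolder.admissible_of_nonpos hθ hr hc)
    · exact ⟨fun h => h.complex_of_real hθ hc T, fun h => h.real_of_complex hθ hr hc S hS⟩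
  obtain ⟨e, he⟩ := SharpHolder.exists_Lp_ne_zero ν hν (ENNReal.ofReal θ)
  have hb : BddAbove {c : ℝ | SharpHolder.Admissible ℝ μ θ r c} :=
    ⟨1, fun c hc => SharpHolder.Admissible.le_one hr T he hc⟩
  refine ⟨SharpHolder.isGreatest_cStar hθ hr hb,
    SharpHolder.isGreatest_cStar hθ hr (heq ▸ hb), ?_⟩
  rw [SharpHolder.cStar, SharpHolder.cStar, heq]
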